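/- Let $n\ge 0$ and $e\ge 1$ be integers, let $S=\mathbb{C}[x_0,\dots,x_n]$ with its standard grading, and let $g_1,\dots,g_n\in S_e$ be homogeneous polynomials of degree $e$ such that $(g_1,\dots,g_n)$ is a regular sequence in $S$. Let $Y(g)$ be the closed subscheme of $\mathbb{P}^n=\operatorname{Proj} S$ defined by the ideal $(g_1,\dots,g_n)$. Then $Y(g)$ is $0$-dimensional: its support $|Y(g)|$ is finite and for every $q\in|Y(g)|$ the local ring $\mathcal{O}_{Y(g),q}$ is Artinian. Let $m'_q$ be the maximal ideal of $\mathcal{O}_{Y(g),q}$ and let $o(m'_q)$ be the smallest integer $k>0$ with $(m'_q)^k=0$. Then $$\sum_{q\in|Y(g)|} o(m'_q)\ \ge\ n(e-1)+1 .$$ The bound is sharp: for all $n\ge 0$ and $e\ge 1$ there are $g_1,\dots,g_n\in S_e$ forming a regular sequence in $S$ for which equality holds. -/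

import Mathlib

open MvPolynomial

attribute [local instance] MvPolynomial.gradedAlgebra

namespace ProjCI

/-- The homogeneous coordinate ring `S = ℂ[x₀, …, xₙ]` of the complex projective space `ℙⁿ`. -/
abbrev S (n : ℕ) : Type := MvPolynomial (Fin (n + 1)) ℂ

/-- The standard grading of `S` by degree. -/
abbrev grading (n : ℕ) : ℕ → Submodule ℂ (S n) :=
  MvPolynomial.homogeneousSubmodule (Fin (n + 1)) ℂ

/-- The underlying set of points of the scheme `ℙⁿ = Proj S`. -/
abbrev Pn (n : ℕ) : Type := ProjectiveSpectrum (grading n)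

/-- The local ring `𝒪_{ℙⁿ,q}`: the fractions `a / s` with `a`, `s` homogeneous of the same
degree and `s` not in the homogeneous prime ideal of `q`. -/
abbrev localRingPn {n : ℕ} (q : Pn n) : Type :=
  HomogeneousLocalization.AtPrime (grading n) q.asHomogeneousIdeal.toIdeal

/-- The stalk at `q` of the ideal sheaf on `ℙⁿ` defined by the homogeneous ideal `J` of `S`: the
elements of `𝒪_{ℙⁿ,q}` which, as fractions, lie in the extension of `J` to the localization of
`S` at the prime ideal of `q`. -/
noncomputable def stalkIdeal {n : ℕ} (J : Ideal (S n)) (q : Pn n) : Ideal (localRingPn q) :=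
  (J.map (algebraMap (S n) (Localization.AtPrime q.asHomogeneousIdeal.toIdeal))).comap
    (algebraMap (localRingPn q) (Localization.AtPrime q.asHomogeneousIdeal.toIdeal))

/-- The ideal of `S` generated by the polynomials `g₁, …, gₙ`. -/
noncomputable def idealOf {n : ℕ} (g : Fin n → S n) : Ideal (S n) := Ideal.span (Set.range g)

/-- The support `|Y(g)|` of the closed subscheme `Y(g)` of `ℙⁿ` defined by `g₁, …, gₙ`. -/
noncomputable def supp {n : ℕ} (g : Fin n → S n) : Set (Pn n) :=
  ProjectiveSpectrum.zeroLocus (grading n) (idealOf g : Set (S n))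

/-- The local ring `𝒪_{Y(g),q}` of the subscheme `Y(g)` at a point `q` of its support. -/
abbrev localRing {n : ℕ} (g : Fin n → S n) (q : supp g) : Type :=
  localRingPn q.1 ⧸ stalkIdeal (idealOf g) q.1

theorem stalkIdeal_ne_top {n : ℕ} (g : Fin n → S n) (q : supp g) :
    stalkIdeal (idealOf g) q.1 ≠ ⊤ := by
  intro h
  have h1 := Ideal.comap_eq_top_iff.1 h
  have hle : idealOf g ≤ q.1.asHomogeneousIdeal.toIdeal := q.2
  have h2 := Ideal.map_mono (f := algebraMap (S n)
    (Localization.AtPrime q.1.asHomogeneousIdeal.toIdeal)) hle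
  rw [h1, Localization.AtPrime.map_eq_maximalIdeal] at h2
  exact (IsLocalRing.maximalIdeal.isMaximal _).ne_top (top_le_iff.1 h2)

instance {n : ℕ} (g : Fin n → S n) (q : supp g) : IsLocalRing (localRing g q) :=
  haveI : Nontrivial (localRing g q) :=
    Ideal.Quotient.nontrivial_iff.2 (stalkIdeal_ne_top g q)
  IsLocalRing.of_surjective' (Ideal.Quotient.mk (stalkIdeal (idealOf g) q.1))
    Ideal.Quotient.mk_surjective

/-- The order `o(m)` of the maximal ideal `m` of a local ring `R` (with `m` nilpotent): the
smallest integer `k > 0` such that `m ^ k = 0`. -/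
noncomputable def maxIdealOrder (R : Type) [CommRing R] [IsLocalRing R] : ℕ :=
  sInf {k : ℕ | 0 < k ∧ IsLocalRing.maximalIdeal R ^ k = ⊥}

end ProjCI

/-! Let `I = (g₁, …, gₙ)` and let `D` be the sum of the orders. Regularity gives the Hilbert series
of `S/I`: multiplied by `1 - X` it is `(1 + X + ⋯ + X^(e-1))^n`, whose coefficient at `n(e-1)` is
`1`. Hence the Hilbert function strictly grows into degree `n(e-1)`, so `I + (l)` misses some form
of that degree for every nonzero linear form `l` (`not_homogeneousSubmodule_le_sup_span`). The
Hilbert function is also bounded, which makes the support finite, the local rings Artinian, and each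
linear form a constant multiple of `l` at any point where `l` does not vanish.

Choose `l` nonvanishing at all points of the support. Given `D` linear forms, allot `o(m'_q)` of
them to each `q` and subtract from each a multiple of `l` to make it vanish at its point. The
product of the corrected forms lies in `I` locally at every point, hence in `I`, because `S/I` has
positive depth (`mem_ofList_of_forall_mul_mem`, `mem_of_forall_exists_mul_mem`). Modulo `l` the
correction is invisible, so all forms of degree at least `D` lie in `I + (l)`, which forces `D >
n(e-1)`.

For sharpness take `x₁^e, …, xₙ^e`: the support has at most one point, and the pigeonhole principle
bounds its order. -/

/-! ### Hilbert functions of homogeneous ideals and complete intersections -/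

section Hilbert

variable {σ K : Type*} [Field K]

instance [Finite σ] (t : ℕ) : Module.Finite K (homogeneousSubmodule σ K t) :=
  Module.Finite.iff_fg.2 (homogeneousSubmodule_fg σ K t)

/-- The degree `t` part of an ideal of a polynomial ring. -/
noncomputable def degPart (I : Ideal (MvPolynomial σ K)) (t : ℕ) :
    Submodule K (MvPolynomial σ K) :=
  I.restrictScalars K ⊓ homogeneousSubmodule σ K t

instance [Finite σ] (I : Ideal (MvPolynomial σ K)) (t : ℕ) : Module.Finite K (degPart I t) :=
  Submodule.finiteDimensional_inf_right _ _

theorem mem_degPart {I : Ideal (MvPolynomial σ K)} {t : ℕ} {f : MvPolynomial σ K} :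
    f ∈ degPart I t ↔ f ∈ I ∧ f.IsHomogeneous t := Iff.rfl

theorem coe_decompose_eq_homogeneousComponent (f : MvPolynomial σ K) (t : ℕ) :
    (DirectSum.decompose (homogeneousSubmodule σ K) f t : MvPolynomial σ K) =
      homogeneousComponent t f :=
  decomposition.decompose'_apply f t

theorem homogeneousComponent_mul_of_isHomogeneous {g : MvPolynomial σ K} {e : ℕ}
    (hg : g.IsHomogeneous e) (b : MvPolynomial σ K) (t : ℕ) :
    homogeneousComponent t (g * b) =
      if e ≤ t then g * homogeneousComponent (t - e) b else 0 := by
  have h := DirectSum.coe_decompose_mul_of_left_mem (homogeneousSubmodule σ K) t (b := b)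
    (show g ∈ homogeneousSubmodule σ K e from hg)
  simp only [coe_decompose_eq_homogeneousComponent] at h
  exact h

/-- Take degree `t` components in an arbitrary decomposition; homogeneity of `I` keeps the first
summand in `I`. The second alternative avoids truncated subtraction when `t < e`. -/
theorem exists_of_mem_sup_span {I : Ideal (MvPolynomial σ K)}
    (hI : I.IsHomogeneous (homogeneousSubmodule σ K)) {g : MvPolynomial σ K} {e : ℕ}
    (hg : g.IsHomogeneous e) {t : ℕ} {f : MvPolynomial σ K} (hf : f.IsHomogeneous t)
    (h : f ∈ I ⊔ Ideal.span {g}) :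
    ∃ a ∈ degPart I t,
      (e ≤ t ∧ ∃ b, b.IsHomogeneous (t - e) ∧ f = a + g * b) ∨ (¬ e ≤ t ∧ f = a) := by
  obtain ⟨a, ha, c, hc, rfl⟩ := Submodule.mem_sup.1 h
  obtain ⟨b, rfl⟩ := Ideal.mem_span_singleton'.1 hc
  refine ⟨homogeneousComponent t a, mem_degPart.2 ⟨homogeneousComponent_mem_of_mem hI ha t,
    homogeneousComponent_isHomogeneous t a⟩, ?_⟩
  have h1 := homogeneousComponent_eq_self hf
  rw [mul_comm b] at h1 ⊢
  rw [map_add, homogeneousComponent_mul_of_isHomogeneous hg] at h1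
  by_cases het : e ≤ t
  · exact .inl ⟨het, _, homogeneousComponent_isHomogeneous (t - e) b, by
      rw [← h1, if_pos het]⟩
  · exact .inr ⟨het, by rw [← h1, if_neg het, add_zero]⟩

theorem degPart_sup_span {I : Ideal (MvPolynomial σ K)}
    (hI : I.IsHomogeneous (homogeneousSubmodule σ K)) {g : MvPolynomial σ K} {e : ℕ}
    (hg : g.IsHomogeneous e) (t : ℕ) :
    degPart (I ⊔ Ideal.span {g}) (e + t) =
      degPart I (e + t) ⊔ (homogeneousSubmodule σ K t).map (LinearMap.mulLeft K g) := by
  apply le_antisymm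
  · intro f hf
    obtain ⟨a, ha, ⟨-, b, hb, rfl⟩ | ⟨h, -⟩⟩ := exists_of_mem_sup_span hI hg hf.2 hf.1
    · rw [Nat.add_sub_cancel_left] at hb
      exact Submodule.add_mem_sup ha ⟨b, hb, rfl⟩
    · omega
  · refine sup_le (fun f hf ↦ ⟨Ideal.mem_sup_left hf.1, hf.2⟩) ?_
    rintro _ ⟨b, hb, rfl⟩
    exact ⟨Ideal.mem_sup_right (Ideal.mul_mem_right _ _ (Ideal.mem_span_singleton_self g)),
      hg.mul hb⟩

theorem degPart_sup_span_of_lt {I : Ideal (MvPolynomial σ K)}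
    (hI : I.IsHomogeneous (homogeneousSubmodule σ K)) {g : MvPolynomial σ K} {e : ℕ}
    (hg : g.IsHomogeneous e) {t : ℕ} (ht : t < e) :
    degPart (I ⊔ Ideal.span {g}) t = degPart I t := by
  refine le_antisymm (fun f hf ↦ ?_) fun f hf ↦ ⟨Ideal.mem_sup_left hf.1, hf.2⟩
  obtain ⟨a, ha, ⟨h, -⟩ | ⟨-, rfl⟩⟩ := exists_of_mem_sup_span hI hg hf.2 hf.1
  · omega
  · exact ha

theorem map_mulLeft_degPart_le (I : Ideal (MvPolynomial σ K)) {g : MvPolynomial σ K} {e : ℕ}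
    (hg : g.IsHomogeneous e) (t : ℕ) :
    (degPart I t).map (LinearMap.mulLeft K g) ≤
      degPart I (e + t) ⊓ (homogeneousSubmodule σ K t).map (LinearMap.mulLeft K g) := by
  rintro _ ⟨b, hb, rfl⟩
  exact ⟨⟨Ideal.mul_mem_left _ _ hb.1, hg.mul hb.2⟩, b, hb.2, rfl⟩

variable (K σ) in
/-- The dimension of the space of forms of degree `t`. -/
noncomputable def formsDim (t : ℕ) : ℕ := Module.finrank K (homogeneousSubmodule σ K t)

/-- The dimension of the space of forms of degree `t` in an ideal. -/
noncomputable def idealDim (I : Ideal (MvPolynomial σ K)) (t : ℕ) : ℕ :=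
  Module.finrank K (degPart I t)

theorem idealDim_top (t : ℕ) : idealDim (⊤ : Ideal (MvPolynomial σ K)) t = formsDim σ K t := by
  have : degPart (⊤ : Ideal (MvPolynomial σ K)) t = homogeneousSubmodule σ K t :=
    le_antisymm inf_le_right fun f hf ↦ ⟨trivial, hf⟩
  rw [idealDim, formsDim, this]

theorem idealDim_mono [Finite σ] {I J : Ideal (MvPolynomial σ K)} (h : I ≤ J) (t : ℕ) :
    idealDim I t ≤ idealDim J t :=
  Submodule.finrank_mono (inf_le_inf_right _ h)

theorem finrank_map_mulLeft {g : MvPolynomial σ K} (hg0 : g ≠ 0)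
    (p : Submodule K (MvPolynomial σ K)) :
    Module.finrank K (p.map (LinearMap.mulLeft K g)) = Module.finrank K p :=
  (p.equivMapOfInjective _ (mul_right_injective₀ hg0)).finrank_eq.symm

/-- The dimension formula for `I_{e+t} + g S_t`, whose intersection term contains `g I_t`. This half
does not need `g` to be regular modulo `I`. -/
theorem idealDim_sup_span_add_le [Finite σ] {I : Ideal (MvPolynomial σ K)}
    (hI : I.IsHomogeneous (homogeneousSubmodule σ K)) {g : MvPolynomial σ K} {e : ℕ}
    (hg : g.IsHomogeneous e) (hg0 : g ≠ 0) (t : ℕ) :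
    idealDim (I ⊔ Ideal.span {g}) (e + t) + idealDim I t ≤
      idealDim I (e + t) + formsDim σ K t := by
  have h := Submodule.finrank_sup_add_finrank_inf_eq (degPart I (e + t))
    ((homogeneousSubmodule σ K t).map (LinearMap.mulLeft K g))
  rw [← degPart_sup_span hI hg, finrank_map_mulLeft hg0] at h
  have h2 := Submodule.finrank_mono (map_mulLeft_degPart_le I hg t)
  rw [finrank_map_mulLeft hg0] at h2
  simp only [idealDim, formsDim]
  omega

/-- Regularity of `g` modulo `I` turns the inclusion of `g I_t` in the intersection into an
equality. -/
theorem idealDim_sup_span_add [Finite σ] {I : Ideal (MvPolynomial σ K)}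
    (hI : I.IsHomogeneous (homogeneousSubmodule σ K)) {g : MvPolynomial σ K} {e : ℕ}
    (hg : g.IsHomogeneous e) (hreg : ∀ x, g * x ∈ I → x ∈ I) (t : ℕ) :
    idealDim (I ⊔ Ideal.span {g}) (e + t) + idealDim I t =
      idealDim I (e + t) + formsDim σ K t := by
  by_cases hg0 : g = 0
  · obtain rfl : I = ⊤ := (Ideal.eq_top_iff_one I).2 (hreg 1 (by simp [hg0]))
    rw [top_sup_eq, idealDim_top, idealDim_top]
  have h := Submodule.finrank_sup_add_finrank_inf_eq (degPart I (e + t))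
    ((homogeneousSubmodule σ K t).map (LinearMap.mulLeft K g))
  have h2 : (degPart I t).map (LinearMap.mulLeft K g) =
      degPart I (e + t) ⊓ (homogeneousSubmodule σ K t).map (LinearMap.mulLeft K g) := by
    refine le_antisymm (map_mulLeft_degPart_le I hg t) ?_
    rintro _ ⟨h1, b, hb, rfl⟩
    exact ⟨b, ⟨hreg b h1.1, hb⟩, rfl⟩
  rw [← degPart_sup_span hI hg, finrank_map_mulLeft hg0, ← h2, finrank_map_mulLeft hg0] at h
  exact h

/-- The Hilbert series of the quotient of a polynomial ring by a homogeneous ideal. -/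
noncomputable def hilbertSeries (I : Ideal (MvPolynomial σ K)) : PowerSeries ℤ :=
  PowerSeries.mk fun t ↦ (formsDim σ K t : ℤ) - idealDim I t

theorem hilbertSeries_sup_span [Finite σ] {I : Ideal (MvPolynomial σ K)}
    (hI : I.IsHomogeneous (homogeneousSubmodule σ K)) {g : MvPolynomial σ K} {e : ℕ}
    (hg : g.IsHomogeneous e) (hreg : ∀ x, g * x ∈ I → x ∈ I) :
    hilbertSeries (I ⊔ Ideal.span {g}) = hilbertSeries I * (1 - PowerSeries.X ^ e) := by
  ext t
  rw [mul_sub, mul_one, map_sub, PowerSeries.coeff_mul_X_pow']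
  simp only [hilbertSeries, PowerSeries.coeff_mk]
  split_ifs with h
  · obtain ⟨t, rfl⟩ := Nat.exists_eq_add_of_le h
    have := idealDim_sup_span_add hI hg hreg t
    rw [Nat.add_sub_cancel_left]
    omega
  · rw [idealDim, degPart_sup_span_of_lt hI hg (not_le.1 h), idealDim, sub_zero]

theorem isHomogeneous_ofList {rs : List (MvPolynomial σ K)} {e : ℕ}
    (h : ∀ r ∈ rs, r.IsHomogeneous e) :
    (Ideal.ofList rs).IsHomogeneous (homogeneousSubmodule σ K) :=
  Ideal.homogeneous_span _ _ fun x hx ↦ ⟨e, h x hx⟩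

theorem RingTheory.Sequence.IsWeaklyRegular.mem_of_mul_mem {R : Type*} [CommRing R] {rs : List R}
    (h : IsWeaklyRegular R rs) (i : ℕ) (hi : i < rs.length) (x : R)
    (hx : rs[i] * x ∈ Ideal.ofList (rs.take i)) : x ∈ Ideal.ofList (rs.take i) := by
  have h1 := h.1 i hi
  rw [isSMulRegular_quotient_iff_mem_of_smul_mem] at h1
  simpa using h1 x (by simpa using hx)

theorem hilbertSeries_ofList [Finite σ] {rs : List (MvPolynomial σ K)} {e : ℕ}
    (h : ∀ r ∈ rs, r.IsHomogeneous e)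
    (hreg : RingTheory.Sequence.IsWeaklyRegular (MvPolynomial σ K) rs) :
    hilbertSeries (Ideal.ofList rs) =
      hilbertSeries (⊥ : Ideal (MvPolynomial σ K)) * (1 - PowerSeries.X ^ e) ^ rs.length := by
  suffices ∀ i ≤ rs.length, hilbertSeries (Ideal.ofList (rs.take i)) =
      hilbertSeries (⊥ : Ideal (MvPolynomial σ K)) * (1 - PowerSeries.X ^ e) ^ i by
    simpa using this _ le_rfl
  intro i hi
  induction i with
  | zero => simp
  | succ i ih =>
    rw [List.take_succ_eq_append_getElem hi, Ideal.ofList_append, Ideal.ofList_singleton,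
      hilbertSeries_sup_span (isHomogeneous_ofList fun r hr ↦ h r (List.mem_of_mem_take hr))
        (h _ (List.getElem_mem _)) (hreg.mem_of_mul_mem i hi), ih (by omega), pow_succ, mul_assoc]

theorem isHomogeneous_mem_of_X_mem {I : Ideal (MvPolynomial σ K)} (hI : ∀ i, X i ∈ I) {t : ℕ}
    (ht : t ≠ 0) {f : MvPolynomial σ K} (hf : f.IsHomogeneous t) : f ∈ I := by
  have h : f ∈ homogeneousSubmodule σ K t := hf
  obtain ⟨t, rfl⟩ := Nat.exists_eq_succ_of_ne_zero ht
  rw [← homogeneousSubmodule_one_pow, pow_succ', homogeneousSubmodule_one_eq_span_X] at h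
  refine (Submodule.mul_le.2 fun a ha b _ ↦ ?_ : _ ≤ I.restrictScalars K) h
  refine Ideal.mul_mem_right _ _ ?_
  refine (Submodule.span_le.2 ?_ : _ ≤ I.restrictScalars K) ha
  rintro _ ⟨i, rfl⟩
  exact hI i

theorem idealDim_irrelevant [Finite σ] {I : Ideal (MvPolynomial σ K)}
    (hI : ∀ i, X i ∈ I) {t : ℕ} (ht : t ≠ 0) : idealDim I t = formsDim σ K t := by
  have h : homogeneousSubmodule σ K t ≤ I.restrictScalars K := fun f hf ↦
    isHomogeneous_mem_of_X_mem hI ht hf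
  rw [idealDim, formsDim, degPart, inf_eq_right.2 h]

theorem formsDim_zero : formsDim σ K 0 = 1 := by
  rw [formsDim, homogeneousSubmodule_zero]
  rw [Submodule.one_eq_span]
  exact finrank_span_singleton one_ne_zero

theorem idealDim_zero [Finite σ] {I : Ideal (MvPolynomial σ K)} (hI : I ≠ ⊤) :
    idealDim I 0 = 0 := by
  refine Submodule.finrank_eq_zero.2 ((Submodule.eq_bot_iff _).2 fun f hf ↦ ?_)
  have h := (mem_degPart.1 hf).2
  rw [← totalDegree_zero_iff_isHomogeneous, totalDegree_eq_zero_iff_eq_C] at h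
  by_contra h0
  refine hI (Ideal.eq_top_of_isUnit_mem _ hf.1 ?_)
  rw [h] at h0 ⊢
  exact (IsUnit.mk0 _ fun h' ↦ h0 (by rw [h', C_0])).map C

theorem hilbertSeries_of_X_mem [Finite σ] {I : Ideal (MvPolynomial σ K)} (htop : I ≠ ⊤)
    (hI : ∀ i, X i ∈ I) : hilbertSeries I = 1 := by
  ext t
  rw [hilbertSeries, PowerSeries.coeff_mk, PowerSeries.coeff_one]
  split_ifs with h
  · rw [h, formsDim_zero, idealDim_zero htop]
    simp
  · rw [idealDim_irrelevant hI h, sub_self]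

open Polynomial in
/-- Hilbert series of a complete intersection of `n` forms of degree `e` in `n + 1` variables. -/
theorem hilbertSeries_ofList_mul [Finite σ] {xs rs : List (MvPolynomial σ K)} {e : ℕ}
    (hxs : ∀ r ∈ xs, r.IsHomogeneous 1)
    (hxreg : RingTheory.Sequence.IsRegular (MvPolynomial σ K) xs)
    (hX : ∀ i, X i ∈ Ideal.ofList xs)
    (hlen : xs.length = rs.length + 1)
    (h : ∀ r ∈ rs, r.IsHomogeneous e)
    (hreg : RingTheory.Sequence.IsWeaklyRegular (MvPolynomial σ K) rs) :
    hilbertSeries (Ideal.ofList rs) * (1 - PowerSeries.X) =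
      (((∑ i ∈ Finset.range e, (Polynomial.X : ℤ[X]) ^ i) ^ rs.length : ℤ[X]) : PowerSeries ℤ) := by
  -- Applied to the sequence `xs`, whose quotient is `K`, the formula reads `1 = H_S (1 - X)^(n+1)`,
  -- with `n` the length of `rs`. This replaces an explicit count of monomials.
  have h1 := hilbertSeries_ofList hxs hxreg.toIsWeaklyRegular
  rw [hilbertSeries_of_X_mem (fun h ↦ hxreg.top_ne_smul (by simp [h])) hX, pow_one, hlen] at h1
  have h3 : ((∑ i ∈ Finset.range e, (Polynomial.X : ℤ[X]) ^ i : ℤ[X]) : PowerSeries ℤ) *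
      (1 - PowerSeries.X) = 1 - PowerSeries.X ^ e := by
    have := congrArg (fun p : ℤ[X] ↦ (p : PowerSeries ℤ)) (geom_sum_mul_neg (Polynomial.X : ℤ[X]) e)
    simpa using this
  rw [hilbertSeries_ofList h hreg, ← h3, mul_pow, Polynomial.coe_pow]
  set G : PowerSeries ℤ := ((∑ i ∈ Finset.range e, (Polynomial.X : ℤ[X]) ^ i : ℤ[X]) : PowerSeries ℤ)
  calc _ = (hilbertSeries (⊥ : Ideal (MvPolynomial σ K)) * (1 - PowerSeries.X) ^ (rs.length + 1)) *
        G ^ rs.length := by ring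
    _ = _ := by rw [← h1, one_mul]

open Polynomial in
theorem coeff_geom_sum_pow (e n : ℕ) (he : 0 < e) :
    ((∑ i ∈ Finset.range e, (Polynomial.X : ℤ[X]) ^ i) ^ n).coeff (n * (e - 1)) = 1 := by
  have hm := (Polynomial.Monic.geom_sum (Polynomial.monic_X (R := ℤ)) (by simp) he.ne')
  have hd : (∑ i ∈ Finset.range e, (Polynomial.X : ℤ[X]) ^ i).natDegree = e - 1 := by
    have h := congrArg Polynomial.natDegree (geom_sum_mul (Polynomial.X : ℤ[X]) e)
    rw [← Polynomial.C_1, Polynomial.natDegree_X_pow_sub_C,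
      hm.natDegree_mul (Polynomial.monic_X_sub_C 1), Polynomial.natDegree_X_sub_C] at h
    omega
  have := (hm.pow n).coeff_natDegree
  rwa [hm.natDegree_pow, hd] at this

/-- Over the coordinate ring of a complete intersection, no linear form generates the forms of
degree `n * (e - 1)`. -/
theorem not_homogeneousSubmodule_le_sup_span [Finite σ] {I : Ideal (MvPolynomial σ K)}
    (hI : I.IsHomogeneous (homogeneousSubmodule σ K)) {p : Polynomial ℤ} {d : ℕ}
    (hp : hilbertSeries I * (1 - PowerSeries.X) = (p : PowerSeries ℤ)) (hd : 0 < p.coeff d)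
    {l : MvPolynomial σ K} (hl : l.IsHomogeneous 1) (hl0 : l ≠ 0) :
    ¬ homogeneousSubmodule σ K d ≤ (I ⊔ Ideal.span {l}).restrictScalars K := by
  intro h
  have h1 : idealDim (I ⊔ Ideal.span {l}) d = formsDim σ K d := by
    rw [idealDim, formsDim, degPart, inf_eq_right.2 h]
  have h2 := congrArg (PowerSeries.coeff d) hp
  rw [Polynomial.coeff_coe] at h2
  cases d with
  | zero =>
    rw [idealDim, degPart_sup_span_of_lt hI hl zero_lt_one, ← idealDim] at h1
    rw [PowerSeries.coeff_zero_eq_constantCoeff_apply, map_mul] at h2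
    simp [hilbertSeries, h1] at h2
    omega
  | succ t =>
    -- If `I + (l)` contained all forms of degree `t + 1`, the Hilbert function of `I` could not
    -- grow from `t` to `t + 1`; but its growth there is the positive coefficient of `p`.
    have h3 := idealDim_sup_span_add_le hI hl hl0 t
    rw [mul_sub, mul_one, map_sub, PowerSeries.coeff_succ_mul_X] at h2
    simp only [hilbertSeries, PowerSeries.coeff_mk] at h2
    rw [add_comm] at h1
    rw [add_comm t 1] at h2 hd
    omega

/-- The coefficients of `p` are the successive differences of the Hilbert function, so it is
constant from the degree of `p` on. -/
theorem exists_formsDim_le [Finite σ] {I : Ideal (MvPolynomial σ K)} {p : Polynomial ℤ}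
    (hp : hilbertSeries I * (1 - PowerSeries.X) = (p : PowerSeries ℤ)) :
    ∃ C, ∀ t, formsDim σ K t ≤ idealDim I t + C := by
  obtain ⟨C, hC⟩ : ∃ C : ℕ, ∀ t ≤ p.natDegree, formsDim σ K t ≤ idealDim I t + C := by
    refine ⟨∑ t ∈ Finset.range (p.natDegree + 1), formsDim σ K t, fun t ht ↦ ?_⟩
    have := Finset.single_le_sum (f := formsDim σ K) (fun _ _ ↦ Nat.zero_le _)
      (Finset.mem_range.2 (show t < p.natDegree + 1 by omega))
    omega
  refine ⟨C, fun t ↦ ?_⟩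
  induction t with
  | zero => exact hC 0 (Nat.zero_le _)
  | succ t ih =>
    by_cases ht : t + 1 ≤ p.natDegree
    · exact hC _ ht
    · have h2 := congrArg (PowerSeries.coeff (t + 1)) hp
      rw [Polynomial.coeff_coe, Polynomial.coeff_eq_zero_of_natDegree_lt (not_le.1 ht),
        mul_sub, mul_one, map_sub, PowerSeries.coeff_succ_mul_X] at h2
      simp only [hilbertSeries, PowerSeries.coeff_mk] at h2
      omega

/-- More forms of degree `t` than the value at `t` of the Hilbert function are linearly dependent
modulo the ideal. -/
theorem exists_sum_smul_mem [Finite σ] {I : Ideal (MvPolynomial σ K)} {t C : ℕ}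
    (hC : formsDim σ K t ≤ idealDim I t + C) {ι : Type*} [Fintype ι] (hι : C < Fintype.card ι)
    (f : ι → MvPolynomial σ K) (hf : ∀ i, (f i).IsHomogeneous t) :
    ∃ c : ι → K, c ≠ 0 ∧ ∑ i, c i • f i ∈ I := by
  let q := (I.restrictScalars K).mkQ.domRestrict (homogeneousSubmodule σ K t)
  have h1 := q.finrank_range_add_finrank_ker
  have h2 : Module.finrank K (LinearMap.ker q) = idealDim I t := by
    have : LinearMap.ker q = (degPart I t).comap (homogeneousSubmodule σ K t).subtype := by
      ext x
      simp [q, degPart]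
    rw [this, idealDim]
    exact (Submodule.comapSubtypeEquivOfLe inf_le_right).finrank_eq
  have h3 : Module.finrank K (LinearMap.range q) < Fintype.card ι := by
    rw [formsDim] at hC
    omega
  have h4 : ¬ LinearIndependent K fun i ↦ q.rangeRestrict ⟨f i, hf i⟩ := fun h ↦
    absurd h.fintype_card_le_finrank (not_le.2 h3)
  obtain ⟨c, hc, i, hi⟩ := Fintype.not_linearIndependent_iff.1 h4
  refine ⟨c, fun h ↦ hi (by simp [h]), ?_⟩
  rw [← Submodule.restrictScalars_mem K, ← Submodule.Quotient.mk_eq_zero,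
    ← Submodule.mkQ_apply, map_sum]
  have := congrArg Subtype.val hc
  simpa [q, -Submodule.Quotient.mk_eq_zero] using this

end Hilbert

/-! ### Depth and vanishing of the socle, through Ext -/

section Socle
open RingTheory.Sequence CategoryTheory Abelian Pointwise IsSMulRegular
universe u

/-- An element of `M` killed by `m` is a map from `R ⧸ m` to `M`, so vanishing of `Ext⁰` settles the
empty sequence. Dividing by a regular element costs one Ext degree, by the long exact sequence. -/
theorem mem_ofList_smul_top_of_subsingleton_ext {R : Type u} [CommRing R] (m : Ideal R)
    (rs : List R) (M : ModuleCat.{u} R) (hreg : IsWeaklyRegular M rs)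
    (hext : ∀ i ≤ rs.length, Subsingleton (Ext (ModuleCat.of R (R ⧸ m)) M i))
    (x : M) (hx : ∀ a ∈ m, a • x ∈ (Ideal.ofList rs • ⊤ : Submodule R M)) :
    x ∈ (Ideal.ofList rs • ⊤ : Submodule R M) := by
  induction rs generalizing M with
  | nil =>
    have : Subsingleton (ModuleCat.of R (R ⧸ m) ⟶ M) :=
      Ext.addEquiv₀.subsingleton_congr.mp (hext 0 le_rfl)
    have : Subsingleton ((R ⧸ m) →ₗ[R] M) :=
      (ModuleCat.homAddEquiv (M := ModuleCat.of R (R ⧸ m)) (N := M)).symm.subsingleton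
    simp only [Ideal.ofList_nil, Submodule.bot_smul, Submodule.mem_bot] at hx ⊢
    have h := Subsingleton.elim (m.liftQ (LinearMap.toSpanSingleton R M x)
      (fun a ha ↦ hx a ha)) 0
    have h1 := LinearMap.congr_fun h (Submodule.Quotient.mk 1)
    have h2 : (1 : R) • x = 0 := h1
    rwa [one_smul] at h2
  | cons r rs ih =>
    rw [isWeaklyRegular_cons_iff] at hreg
    have key (y : M) : y ∈ (Ideal.ofList (r :: rs) • ⊤ : Submodule R M) ↔
        Submodule.Quotient.mk y ∈ (Ideal.ofList rs • ⊤ : Submodule R (QuotSMulTop r M)) := by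
      have h := Submodule.comap_smul_top_of_surjective (Ideal.ofList rs)
        (Submodule.mkQ (r • ⊤ : Submodule R M)) (Submodule.mkQ_surjective _)
      have h' := SetLike.ext_iff.1 h y
      rw [Ideal.ofList_cons_smul, sup_comm]
      simpa using h'.symm
    rw [key]
    refine ih (ModuleCat.of R (QuotSMulTop r M)) hreg.2 (fun i hi ↦ ?_) _ fun a ha ↦ ?_
    · have zero1 := AddCommGrpCat.isZero_of_iff_subsingleton.mpr
        (hext i (by simp; omega))
      have zero2 := AddCommGrpCat.isZero_of_iff_subsingleton.mpr
        (hext (i + 1) (by simp; omega))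
      exact AddCommGrpCat.subsingleton_of_isZero <| ShortComplex.Exact.isZero_of_both_zeros
        ((Ext.covariant_sequence_exact₃' (ModuleCat.of R (R ⧸ m))
          hreg.1.smulShortComplex_shortExact) i (i + 1) rfl)
        (zero1.eq_zero_of_src _) (zero2.eq_zero_of_tgt _)
    · exact (key (a • x)).1 (hx a ha)

/-- The sequence `as` in `m` makes `Ext^i(R ⧸ m, R)` vanish for `i < as.length`, and `rs` is
shorter. With the variables for `as`, this says that the complete intersection ideal is saturated.
-/
theorem mem_ofList_of_forall_mul_mem {R : Type u} [CommRing R] [IsNoetherianRing R] (m : Ideal R)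
    (hm : m ≠ ⊤) (as rs : List R) (has : ∀ a ∈ as, a ∈ m) (has' : IsRegular R as)
    (hrs : IsWeaklyRegular R rs) (hlen : rs.length < as.length) (x : R)
    (hx : ∀ a ∈ m, a * x ∈ Ideal.ofList rs) : x ∈ Ideal.ofList rs := by
  have h := mem_ofList_smul_top_of_subsingleton_ext m rs (ModuleCat.of R R) hrs
    (fun i hi ↦ ModuleCat.subsingleton_ext_of_exists_isRegular m (ModuleCat.of R (R ⧸ m))
      (by rw [Module.support_eq_zeroLocus, Ideal.annihilator_quotient])
      (ModuleCat.of R R) (lt_top_iff_ne_top.2 (by simpa using hm)) as has has' i (hi.trans_lt hlen))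
    x
  simp only [smul_eq_mul, Ideal.mul_top] at h
  exact h hx

end Socle

/-! ### Regular sequences of powers of variables -/

section MonomialSequence

variable {σ K : Type*} [Field K]

theorem ofList_take_ofFn {R : Type*} [CommRing R] {k : ℕ} (f : Fin k → R) (i : ℕ) :
    Ideal.ofList ((List.ofFn f).take i) = Ideal.span (f '' {j | (j : ℕ) < i}) := by
  rw [Ideal.ofList]
  congr 1
  ext r
  simp only [Set.mem_ofPred_eq, Set.mem_image, List.mem_take_iff_getElem, List.getElem_ofFn,
    List.length_ofFn]
  constructor
  · rintro ⟨j, hj, rfl⟩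
    exact ⟨⟨j, by omega⟩, by simp; omega, rfl⟩
  · rintro ⟨j, hj, rfl⟩
    exact ⟨j, by simp; omega, rfl⟩

theorem mem_span_X_pow_image {k : ℕ} (v : Fin k → σ) (e : ℕ) (s : Set (Fin k))
    (f : MvPolynomial σ K) :
    f ∈ Ideal.span ((fun j ↦ (X (v j) ^ e : MvPolynomial σ K)) '' s) ↔
      ∀ d ∈ f.support, ∃ j ∈ s, e ≤ d (v j) := by
  have h : (fun j ↦ (X (v j) ^ e : MvPolynomial σ K)) '' s =
      (fun d ↦ monomial d (1 : K)) '' ((fun j ↦ Finsupp.single (v j) e) '' s) := by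
    rw [Set.image_image]
    simp only [X_pow_eq_monomial]
  rw [h, mem_ideal_span_monomial_image]
  simp

/-- Powers of distinct variables form a regular sequence. -/
theorem isRegular_ofFn_X_pow {k : ℕ} (v : Fin k → σ) (hv : Function.Injective v) (e : ℕ)
    (he : 0 < e) :
    RingTheory.Sequence.IsRegular (MvPolynomial σ K)
      (List.ofFn fun i ↦ (X (v i) ^ e : MvPolynomial σ K)) := by
  refine ⟨⟨fun i hi ↦ ?_⟩, fun h ↦ ?_⟩
  · rw [isSMulRegular_quotient_iff_mem_of_smul_mem]
    intro f hf
    rw [smul_eq_mul, Ideal.mul_top, ofList_take_ofFn] at hf ⊢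
    rw [mem_span_X_pow_image] at hf ⊢
    intro d hd
    rw [List.length_ofFn] at hi
    -- Multiplying by the `i`-th power shifts only the exponent of `v i`, so a divisibility by an
    -- earlier variable was already present in `d`.
    obtain ⟨j, hj, hjd⟩ := hf (Finsupp.single (v ⟨i, hi⟩) e + d) (by
      rw [List.getElem_ofFn, smul_eq_mul, X_pow_eq_monomial, mem_support_iff, coeff_monomial_mul,
        one_mul]
      exact mem_support_iff.1 hd)
    refine ⟨j, hj, ?_⟩
    have hne : v ⟨i, hi⟩ ≠ v j := fun h ↦ by
      have := hv h
      simp [← this] at hj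
    simpa [Finsupp.single_eq_of_ne' hne] using hjd
  · have h1 := ofList_take_ofFn (fun i ↦ (X (v i) ^ e : MvPolynomial σ K)) k
    rw [List.take_of_length_le (by simp)] at h1
    rw [smul_eq_mul, Ideal.mul_top, h1] at h
    have h2 : (1 : MvPolynomial σ K) ∈ (⊤ : Ideal (MvPolynomial σ K)) := trivial
    rw [h, mem_span_X_pow_image] at h2
    obtain ⟨j, -, hj⟩ := h2 0 (by simp)
    simp at hj
    omega

end MonomialSequence

/-! ### Linear forms modulo primes with bounded Hilbert function -/

section Points

variable {σ K : Type*} [Field K]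

theorem mem_range_algebraMap_of_isIntegral {F : Type*} [Field F] [Algebra K F] [IsAlgClosed K]
    {z : F} (hz : IsIntegral K z) : ∃ c : K, algebraMap K F c = z := by
  obtain ⟨y, hy⟩ := (IsAlgClosed.algebraMap_bijective_of_isIntegral (k := K)
    (K := integralClosure K F)).2 ⟨z, hz⟩
  exact ⟨y, congr_arg Subtype.val hy⟩

/-- A prime ideal with bounded Hilbert function contains a hyperplane of linear forms. -/
theorem exists_sub_C_mul_mem [Finite σ] [IsAlgClosed K] {P : Ideal (MvPolynomial σ K)} [P.IsPrime]
    {m : ℕ} (hm : ∀ t, formsDim σ K t ≤ idealDim P t + m) {l y : MvPolynomial σ K}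
    (hl : l.IsHomogeneous 1) (hlP : l ∉ P) (hy : y.IsHomogeneous 1) :
    ∃ c : K, y - C c * l ∈ P := by
  -- The `m + 1` forms `y^j l^(m-j)` of degree `m` are dependent modulo `P`. Dividing by `l^m` gives
  -- an algebraic equation for `y / l` over `K`, so `y / l` is a constant.
  obtain ⟨c, hc, hsum⟩ := exists_sum_smul_mem (hm m) (ι := Fin (m + 1)) (by simp)
    (fun j ↦ y ^ (j : ℕ) * l ^ (m - j : ℕ)) (fun j ↦ by
      have := (hy.pow j).mul (hl.pow (m - j))
      rwa [one_mul, one_mul, Nat.add_sub_cancel' (by omega)] at this)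
  let F := FractionRing (MvPolynomial σ K ⧸ P)
  let φ : MvPolynomial σ K →ₐ[K] F :=
    (IsScalarTower.toAlgHom K (MvPolynomial σ K ⧸ P) F).comp (Ideal.Quotient.mkₐ K P)
  have hφ (f : MvPolynomial σ K) : φ f = 0 ↔ f ∈ P := by
    rw [← Ideal.Quotient.eq_zero_iff_mem]
    exact map_eq_zero_iff _ (IsFractionRing.injective (MvPolynomial σ K ⧸ P) F)
  have hl0 : φ l ≠ 0 := fun h ↦ hlP ((hφ l).1 h)
  have hz : IsAlgebraic K (φ y / φ l) := by
    refine ⟨∑ j : Fin (m + 1), Polynomial.monomial (j : ℕ) (c j), fun h ↦ hc ?_, ?_⟩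
    · ext i
      have := congrArg (fun p ↦ Polynomial.coeff p i) h
      simpa [Polynomial.finsetSum_coeff, Polynomial.coeff_monomial, Fin.val_inj] using this
    · have h := (hφ _).2 hsum
      rw [map_sum] at h ⊢
      have h2 : φ l ^ m * ∑ j : Fin (m + 1),
          Polynomial.aeval (φ y / φ l) (Polynomial.monomial (j : ℕ) (c j)) = 0 := by
        rw [← h, Finset.mul_sum]
        refine Finset.sum_congr rfl fun j _ ↦ ?_
        rw [Polynomial.aeval_monomial, map_smul, map_mul, map_pow, map_pow, Algebra.smul_def,
          div_pow]
        have : φ l ^ m = φ l ^ (j : ℕ) * φ l ^ (m - j : ℕ) := by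
          rw [← pow_add, Nat.add_sub_cancel' (by omega)]
        rw [this, mul_left_comm, mul_right_comm, mul_div_cancel₀ _ (pow_ne_zero _ hl0)]
      exact (mul_eq_zero.1 h2).resolve_left (pow_ne_zero _ hl0)
  obtain ⟨a, ha⟩ := mem_range_algebraMap_of_isIntegral hz.isIntegral
  refine ⟨a, (hφ _).1 ?_⟩
  rw [map_sub, map_mul, ← algebraMap_eq, φ.commutes, ha, div_mul_cancel₀ _ hl0, sub_self]

theorem exists_sub_C_mul_pow_mem {Q : Ideal (MvPolynomial σ K)} {l : MvPolynomial σ K}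
    (h : ∀ y : MvPolynomial σ K, y.IsHomogeneous 1 → ∃ c : K, y - C c * l ∈ Q) {k : ℕ}
    {f : MvPolynomial σ K} (hf : f.IsHomogeneous k) : ∃ c : K, f - C c * l ^ k ∈ Q := by
  have hf' : f ∈ homogeneousSubmodule σ K k := hf
  clear hf
  rw [← homogeneousSubmodule_one_pow] at hf'
  induction k generalizing f with
  | zero =>
    obtain ⟨c, rfl⟩ := Submodule.mem_one.1 (by rwa [pow_zero] at hf')
    exact ⟨c, by simp [algebraMap_eq]⟩
  | succ k ih =>
    rw [pow_succ] at hf'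
    induction hf' using Submodule.mul_induction_on' with
    | mem_mul_mem a ha b hb =>
      obtain ⟨c, hc⟩ := ih ha
      obtain ⟨c', hc'⟩ := h b hb
      refine ⟨c * c', ?_⟩
      have := Q.add_mem (Q.mul_mem_right b hc) (Q.mul_mem_left (C c * l ^ k) hc')
      convert this using 1
      rw [C_mul]
      ring
    | add a _ b _ ha hb =>
      obtain ⟨c, hc⟩ := ha
      obtain ⟨c', hc'⟩ := hb
      refine ⟨c + c', ?_⟩
      convert Q.add_mem hc hc' using 1
      rw [C_add]
      ring

/-- A form of degree `k` is `c l^k` modulo `P ⊓ P'`; if it lies in `P`, then `c = 0` because `l ∉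
P`, and so it lies in `P'`. -/
theorem le_of_forall_exists_sub_mem {P P' : Ideal (MvPolynomial σ K)} [P.IsPrime]
    (hP : P.IsHomogeneous (homogeneousSubmodule σ K)) {l : MvPolynomial σ K} (hlP : l ∉ P)
    (h : ∀ y : MvPolynomial σ K, y.IsHomogeneous 1 → ∃ c : K, y - C c * l ∈ P ⊓ P') : P ≤ P' := by
  intro f hf
  rw [← sum_homogeneousComponent f]
  refine Ideal.sum_mem _ fun k _ ↦ ?_
  have hk := homogeneousComponent_mem_of_mem hP hf k
  obtain ⟨c, hc⟩ := exists_sub_C_mul_pow_mem h (homogeneousComponent_isHomogeneous k f)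
  have h1 : C c * l ^ k ∈ P := by
    have := P.sub_mem hk hc.1
    rwa [sub_sub_cancel] at this
  obtain rfl : c = 0 := by
    by_contra hc0
    refine (Ideal.IsPrime.mem_or_mem ‹_› h1).elim (fun h2 ↦ ?_) fun h2 ↦
      hlP (Ideal.IsPrime.mem_of_pow_mem ‹_› _ h2)
    exact Ideal.IsPrime.ne_top ‹_› (Ideal.eq_top_of_isUnit_mem _ h2 ((IsUnit.mk0 c hc0).map C))
  simpa using hc.2

end Points

/-! ### Finiteness of the support -/

section Points

variable {n : ℕ}

theorem exists_X_notMem (q : ProjCI.Pn n) : ∃ i, X i ∉ q.asHomogeneousIdeal.toIdeal := by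
  by_contra! h
  refine q.not_irrelevant_le ?_
  rw [HomogeneousIdeal.irrelevant_le]
  exact fun i hi f hf ↦ isHomogeneous_mem_of_X_mem h hi.ne' hf

/-- A closed subscheme of projective space with bounded Hilbert function contains no pair of
distinct comparable points. -/
theorem eq_of_toIdeal_le {I : Ideal (ProjCI.S n)} {m : ℕ}
    (hm : ∀ t, formsDim (Fin (n + 1)) ℂ t ≤ idealDim I t + m) {q p : ProjCI.Pn n}
    (hq : I ≤ q.asHomogeneousIdeal.toIdeal)
    (hqp : q.asHomogeneousIdeal.toIdeal ≤ p.asHomogeneousIdeal.toIdeal) : q = p := by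
  have := q.isPrime
  have := p.isPrime
  obtain ⟨i, hi⟩ := exists_X_notMem p
  refine ProjectiveSpectrum.ext (HomogeneousIdeal.toIdeal_injective (le_antisymm hqp ?_))
  -- A constant that works modulo the smaller prime `q` works modulo both.
  refine le_of_forall_exists_sub_mem p.asHomogeneousIdeal.isHomogeneous hi
    fun y hy ↦ ?_
  obtain ⟨c, hc⟩ := exists_sub_C_mul_mem (P := q.asHomogeneousIdeal.toIdeal)
    (fun t ↦ (hm t).trans (Nat.add_le_add_right (idealDim_mono hq t) m))
    (isHomogeneous_X ℂ i) (fun h ↦ hi (hqp h)) hy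
  exact ⟨c, hqp hc, hc⟩

/-- A homogeneous prime ideal not containing all variables is a point of projective space. -/
def pointOfPrime (P : Ideal (ProjCI.S n)) (hP : P.IsHomogeneous (ProjCI.grading n))
    (hP' : P.IsPrime) (h : ∃ i, X i ∉ P) : ProjCI.Pn n where
  asHomogeneousIdeal := ⟨P, hP⟩
  isPrime := hP'
  not_irrelevant_le hle := by
    obtain ⟨i, hi⟩ := h
    exact hi (hle (HomogeneousIdeal.mem_irrelevant_of_mem _ zero_lt_one (isHomogeneous_X ℂ i)))

/-- Every point of the zero locus is a minimal prime of `I`, and a Noetherian ring has finitely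
many. A smaller prime over `I` need not be homogeneous, so its homogeneous core is compared with the
point instead. -/
theorem finite_zeroLocus {I : Ideal (ProjCI.S n)} (hI : I.IsHomogeneous (ProjCI.grading n)) {m : ℕ}
    (hm : ∀ t, formsDim (Fin (n + 1)) ℂ t ≤ idealDim I t + m) :
    (ProjectiveSpectrum.zeroLocus (ProjCI.grading n) (I : Set (ProjCI.S n))).Finite := by
  refine Set.Finite.of_finite_image (f := fun q ↦ q.asHomogeneousIdeal.toIdeal)
    ((Ideal.finite_minimalPrimes_of_isNoetherianRing _ I).subset ?_)
    fun p _ q _ h ↦ ProjectiveSpectrum.ext (HomogeneousIdeal.toIdeal_injective h)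
  rintro _ ⟨q, hq, rfl⟩
  refine ⟨⟨q.isPrime, hq⟩, fun J hJ hJq ↦ ?_⟩
  have hcore : I ≤ (J.homogeneousCore (ProjCI.grading n)).toIdeal := by
    have h := Ideal.homogeneousCore_mono (ProjCI.grading n) hJ.2
    rwa [← toIdeal_le_toIdeal_iff, hI.toIdeal_homogeneousCore_eq_self] at h
  have hle := Ideal.toIdeal_homogeneousCore_le (ProjCI.grading n) J
  obtain ⟨i, hi⟩ := exists_X_notMem q
  have h := eq_of_toIdeal_le hm (q := pointOfPrime _ (J.homogeneousCore _).isHomogeneous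
    hJ.1.homogeneousCore ⟨i, fun h ↦ hi (hJq (hle h))⟩) (p := q) hcore (hle.trans hJq)
  rw [← h]
  exact hle

end Points

/-! ### Artinian local rings and their nilpotency order -/

section LocalRings

theorem isArtinianRing_of_forall_finset {K B : Type*} [Field K] [CommRing B] (φ : K →+* B) (m : ℕ)
    (h : ∀ s : Finset B, m < s.card → ∃ c : s → K, c ≠ 0 ∧ ∑ b, φ (c b) * b = 0) :
    IsArtinianRing B := by
  let := φ.toAlgebra
  have hr : Module.rank K B ≤ m := rank_le fun s hs ↦ by
    by_contra! hlt
    obtain ⟨c, hc, hsum⟩ := h s hlt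
    rw [Fintype.linearIndependent_iff] at hs
    exact hc (funext (hs c hsum))
  have : Module.Finite K B :=
    Module.rank_lt_aleph0_iff.1 (hr.trans_lt (Cardinal.natCast_lt_aleph0))
  exact IsArtinianRing.of_finite K B

variable {n : ℕ}

/-- The local ring of the ambient ring at the homogeneous prime ideal of a point. -/
abbrev ambientLocalRing (q : ProjCI.Pn n) : Type :=
  Localization.AtPrime q.asHomogeneousIdeal.toIdeal

theorem exists_val_mul_eq (q : ProjCI.Pn n) (x : ProjCI.localRingPn q) :
    ∃ t, ∃ a d : ProjCI.S n, a.IsHomogeneous t ∧ d.IsHomogeneous t ∧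
      d ∉ q.asHomogeneousIdeal.toIdeal ∧
      x.val * algebraMap (ProjCI.S n) (ambientLocalRing q) d = algebraMap _ _ a := by
  obtain ⟨⟨t, a, d, hd⟩, rfl⟩ := HomogeneousLocalization.mk_surjective x
  refine ⟨t, a, d, a.2, d.2, hd, ?_⟩
  rw [HomogeneousLocalization.val_mk, Localization.mk_eq_mk']
  exact IsLocalization.mk'_spec _ _ ⟨(d : ProjCI.S n), hd⟩

theorem exists_common_denominator (q : ProjCI.Pn n) {ι : Type*} (s : Finset ι)
    (f : ι → ProjCI.localRingPn q) :
    ∃ t, ∃ d : ProjCI.S n, d.IsHomogeneous t ∧ d ∉ q.asHomogeneousIdeal.toIdeal ∧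
      ∀ i ∈ s, ∃ a : ProjCI.S n, a.IsHomogeneous t ∧
        (f i).val * algebraMap (ProjCI.S n) (ambientLocalRing q) d = algebraMap _ _ a := by
  classical
  have := q.isPrime
  induction s using Finset.induction_on with
  | empty =>
    exact ⟨0, 1, isHomogeneous_one _ _, fun h ↦ q.isPrime.ne_top ((Ideal.eq_top_iff_one _).2 h),
      by simp⟩
  | insert j s _ ih =>
    obtain ⟨t, d, hd, hdq, h⟩ := ih
    obtain ⟨t', a', d', ha', hd', hdq', h'⟩ := exists_val_mul_eq q (f j)
    refine ⟨t + t', d * d', hd.mul hd', fun hm ↦ (q.isPrime.mem_or_mem hm).elim hdq hdq',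
      fun i hi ↦ ?_⟩
    rcases Finset.mem_insert.1 hi with rfl | hi
    · refine ⟨d * a', hd.mul ha', ?_⟩
      rw [map_mul, map_mul, ← h']
      ring
    · obtain ⟨a, ha, hai⟩ := h i hi
      refine ⟨a * d', ha.mul hd', ?_⟩
      rw [map_mul, map_mul, ← hai]
      ring

theorem mem_stalkIdeal_of_val_mul_eq {I : Ideal (ProjCI.S n)} {q : ProjCI.Pn n}
    {x : ProjCI.localRingPn q} {a d : ProjCI.S n} (hd : d ∉ q.asHomogeneousIdeal.toIdeal)
    (h : x.val * algebraMap (ProjCI.S n) (ambientLocalRing q) d = algebraMap _ _ a) (ha : a ∈ I) :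
    x ∈ ProjCI.stalkIdeal I q := by
  have hu : IsUnit (algebraMap (ProjCI.S n) (ambientLocalRing q) d) :=
    IsLocalization.map_units (ambientLocalRing q)
      (⟨d, hd⟩ : q.asHomogeneousIdeal.toIdeal.primeCompl)
  refine Ideal.mem_comap.2 ((Ideal.mul_unit_mem_iff_mem _ hu).1 ?_)
  exact h ▸ Ideal.mem_map_of_mem _ ha

theorem isArtinianRing_quotient_stalkIdeal {I : Ideal (ProjCI.S n)} {m : ℕ}
    (hm : ∀ t, formsDim (Fin (n + 1)) ℂ t ≤ idealDim I t + m) (q : ProjCI.Pn n) :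
    IsArtinianRing (ProjCI.localRingPn q ⧸ ProjCI.stalkIdeal I q) := by
  let ψ : ℂ →+* ProjCI.localRingPn q :=
    (algebraMap (ProjCI.grading n 0) _).comp (algebraMap ℂ (ProjCI.grading n 0))
  have hψ (c : ℂ) : (ψ c).val = algebraMap (ProjCI.S n) (ambientLocalRing q) (C c) := rfl
  refine isArtinianRing_of_forall_finset
    ((Ideal.Quotient.mk (ProjCI.stalkIdeal I q)).comp ψ) m fun s hs ↦ ?_
  let f : s → ProjCI.localRingPn q := fun b ↦ Quotient.out b.1
  have hf (b : s) : Ideal.Quotient.mk (ProjCI.stalkIdeal I q) (f b) = b := Quotient.out_eq b.1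
  -- Over a common denominator of degree `t` the numerators are more than `m` forms of degree `t`,
  -- hence dependent modulo `I`; so the local ring has dimension at most `m` over `ℂ`.
  obtain ⟨t, d, hd, hdq, h⟩ := exists_common_denominator q Finset.univ f
  choose a ha hfa using fun b ↦ h b (Finset.mem_univ b)
  obtain ⟨c, hc, hsum⟩ := exists_sum_smul_mem (hm t) (by simpa using hs) a ha
  refine ⟨c, hc, ?_⟩
  have hz : ∑ b, ψ (c b) * f b ∈ ProjCI.stalkIdeal I q := by
    refine mem_stalkIdeal_of_val_mul_eq hdq ?_ hsum
    rw [← HomogeneousLocalization.algebraMap_apply, map_sum, Finset.sum_mul, map_sum]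
    refine Finset.sum_congr rfl fun b _ ↦ ?_
    rw [map_mul, HomogeneousLocalization.algebraMap_apply, HomogeneousLocalization.algebraMap_apply,
      mul_assoc, hfa, hψ, ← map_mul, smul_eq_C_mul]
  rw [← Ideal.Quotient.eq_zero_iff_mem, map_sum] at hz
  simpa [hf] using hz

theorem maxIdealOrder_spec (R : Type) [CommRing R] [IsLocalRing R] [IsArtinianRing R] :
    IsLocalRing.maximalIdeal R ^ ProjCI.maxIdealOrder R = ⊥ := by
  obtain ⟨k, hk⟩ := IsArtinianRing.isNilpotent_jacobson_bot (R := R)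
  rw [IsLocalRing.jacobson_eq_maximalIdeal _ bot_ne_top] at hk
  exact (Nat.sInf_mem (s := {k : ℕ | 0 < k ∧ IsLocalRing.maximalIdeal R ^ k = ⊥})
    ⟨k + 1, k.succ_pos, by rw [pow_succ, hk, zero_mul]; rfl⟩).2

/-- Products of `o(m'_q)` linear forms vanishing at `q` lie in the ideal of the subscheme,
locally at `q`. -/
theorem exists_mul_prod_mem (g : Fin n → ProjCI.S n) (q : ProjCI.supp g)
    [IsArtinianRing (ProjCI.localRing g q)] {l : ProjCI.S n} (hl : l.IsHomogeneous 1)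
    (hlq : l ∉ q.1.asHomogeneousIdeal.toIdeal) {ι : Type*} (s : Finset ι)
    (hs : s.card = ProjCI.maxIdealOrder (ProjCI.localRing g q)) (y : ι → ProjCI.S n)
    (hy : ∀ i, (y i).IsHomogeneous 1) (hyq : ∀ i, y i ∈ q.1.asHomogeneousIdeal.toIdeal) :
    ∃ r ∉ q.1.asHomogeneousIdeal.toIdeal, r * ∏ i ∈ s, y i ∈ ProjCI.idealOf g := by
  let τ := algebraMap (ProjCI.S n) (ambientLocalRing q.1)
  let x : ι → ProjCI.localRingPn q.1 := fun i ↦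
    HomogeneousLocalization.mk ⟨1, ⟨y i, hy i⟩, ⟨l, hl⟩, hlq⟩
  have hx (i) : (x i).val * τ l = τ (y i) := by
    rw [HomogeneousLocalization.val_mk, Localization.mk_eq_mk']
    exact IsLocalization.mk'_spec _ _ (⟨l, hlq⟩ : q.1.asHomogeneousIdeal.toIdeal.primeCompl)
  have hl' : IsUnit (τ l) := IsLocalization.map_units (ambientLocalRing q.1)
      (⟨l, hlq⟩ : q.1.asHomogeneousIdeal.toIdeal.primeCompl)
  have hxm (i) : Ideal.Quotient.mk (ProjCI.stalkIdeal (ProjCI.idealOf g) q.1) (x i) ∈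
      IsLocalRing.maximalIdeal (ProjCI.localRing g q) := by
    have : IsLocalHom (Ideal.Quotient.mk (ProjCI.stalkIdeal (ProjCI.idealOf g) q.1)) :=
      IsLocalHom.of_surjective _ Ideal.Quotient.mk_surjective
    rw [IsLocalRing.mem_maximalIdeal, mem_nonunits_iff]
    intro hu
    have h1 := ((HomogeneousLocalization.isUnit_iff_isUnit_val _ _ _).2
      (isUnit_of_map_unit _ _ hu)).mul hl'
    rw [hx] at h1
    exact (IsLocalization.AtPrime.isUnit_to_map_iff _ q.1.asHomogeneousIdeal.toIdeal _).1 h1 (hyq i)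
  have h1 : ∏ i ∈ s, x i ∈ ProjCI.stalkIdeal (ProjCI.idealOf g) q.1 := by
    rw [← Ideal.Quotient.eq_zero_iff_mem, map_prod, ← Ideal.mem_bot,
      ← maxIdealOrder_spec (ProjCI.localRing g q), ← hs, ← Finset.prod_const]
    exact Ideal.prod_mem_prod fun i _ ↦ hxm i
  have h2 : τ (∏ i ∈ s, y i) ∈ (ProjCI.idealOf g).map τ := by
    have h3 := Ideal.mul_mem_right (∏ _i ∈ s, τ l) _ (Ideal.mem_comap.1 h1)
    rw [map_prod, ← Finset.prod_mul_distrib] at h3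
    rw [map_prod]
    convert h3 using 2 with i
    exact (hx i).symm
  obtain ⟨r, hr, h⟩ := (IsLocalization.algebraMap_mem_map_algebraMap_iff
    q.1.asHomogeneousIdeal.toIdeal.primeCompl (ambientLocalRing q.1) _ _).1 h2
  exact ⟨r, hr, h⟩

end LocalRings

/-! ### Saturation and the lower bound -/

section LowerBound

variable {n : ℕ}

theorem exists_linear_form_notMem {ι : Type*} [Finite ι] (q : ι → ProjCI.Pn n) :
    ∃ l : ProjCI.S n, l.IsHomogeneous 1 ∧ l ≠ 0 ∧ ∀ i, l ∉ (q i).asHomogeneousIdeal.toIdeal := by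
  -- Over an infinite field, finitely many proper subspaces do not cover the linear forms. The extra
  -- zero subspace secures `l ≠ 0` even when there are no points.
  let p : Option ι → Subspace ℂ (ProjCI.grading n 1) := fun i ↦
    i.elim ⊥ fun i ↦ ((q i).asHomogeneousIdeal.toIdeal.restrictScalars ℂ).comap
      (ProjCI.grading n 1).subtype
  have hp : ⋃ i, (p i : Set (ProjCI.grading n 1)) ≠ Set.univ := fun h ↦ by
    obtain ⟨i, hi⟩ := Subspace.exists_eq_top_of_iUnion_eq_univ h
    have htop (j) : (⟨X j, isHomogeneous_X ℂ j⟩ : ProjCI.grading n 1) ∈ p i := hi ▸ trivial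
    cases i with
    | none => exact X_ne_zero (R := ℂ) (0 : Fin (n + 1)) (congrArg Subtype.val (htop 0))
    | some i =>
      obtain ⟨j, hj⟩ := exists_X_notMem (q i)
      exact hj (htop j)
  obtain ⟨l, hl⟩ := (Set.ne_univ_iff_exists_notMem _).1 hp
  simp only [Set.mem_iUnion, not_exists] at hl
  exact ⟨l, l.2, fun h ↦ hl none (Subtype.ext h), fun i h ↦ hl (some i) h⟩

theorem isRegular_ofFn_X (k : ℕ) :
    RingTheory.Sequence.IsRegular (MvPolynomial (Fin k) ℂ)
      (List.ofFn (X : Fin k → MvPolynomial (Fin k) ℂ)) := by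
  simpa using isRegular_ofFn_X_pow (K := ℂ) (id : Fin k → Fin k) Function.injective_id 1 one_pos

theorem ofList_ofFn {R : Type*} [CommRing R] {k : ℕ} (f : Fin k → R) :
    Ideal.ofList (List.ofFn f) = Ideal.span (Set.range f) := by
  rw [Ideal.ofList]
  congr 1
  ext x
  exact List.mem_ofFn

theorem mem_of_pow_mul_mem {R : Type*} [CommRing R] {I m : Ideal R}
    (h : ∀ f, (∀ a ∈ m, a * f ∈ I) → f ∈ I) {k : ℕ} {f : R}
    (hf : ∀ a ∈ m ^ k, a * f ∈ I) : f ∈ I := by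
  induction k with
  | zero => simpa using hf 1 (by simp)
  | succ k ih =>
    refine ih fun a ha ↦ h _ fun b hb ↦ ?_
    rw [← mul_assoc]
    exact hf _ (pow_succ' m k ▸ Ideal.mul_mem_mul hb ha)

/-- A form which locally at every point lies in a saturated homogeneous ideal lies in the ideal. -/
theorem mem_of_forall_exists_mul_mem {I : Ideal (ProjCI.S n)}
    (hI : I.IsHomogeneous (ProjCI.grading n))
    (hsat : ∀ f, (∀ a ∈ Ideal.span (Set.range X), a * f ∈ I) → f ∈ I) {k : ℕ} {f : ProjCI.S n}
    (hf : f.IsHomogeneous k)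
    (h : ∀ q : ProjCI.Pn n, I ≤ q.asHomogeneousIdeal.toIdeal →
      ∃ r ∉ q.asHomogeneousIdeal.toIdeal, r * f ∈ I) : f ∈ I := by
  -- The colon ideal `I : f` is homogeneous and lies in no point of projective space, so its radical
  -- contains every variable and it contains a power of the irrelevant ideal; `hsat` then removes
  -- that power.
  let J : Ideal (ProjCI.S n) := Submodule.comap (LinearMap.toSpanSingleton _ _ f) I
  have hmem (a) : a ∈ J ↔ a * f ∈ I := Iff.rfl
  have hJ : J.IsHomogeneous (ProjCI.grading n) := fun i a ha ↦ by
    have h1 := homogeneousComponent_mem_of_mem hI ((hmem a).1 ha) (k + i)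
    rw [mul_comm, homogeneousComponent_mul_of_isHomogeneous hf, if_pos (Nat.le_add_right _ _),
      Nat.add_sub_cancel_left, mul_comm] at h1
    rw [hmem, coe_decompose_eq_homogeneousComponent]
    exact h1
  have hrad : Ideal.span (Set.range X) ≤ J.radical := by
    rw [Ideal.span_le]
    rintro _ ⟨i, rfl⟩
    rw [Ideal.radical_eq_sInf, SetLike.mem_coe, Submodule.mem_sInf]
    rintro p ⟨hJp, hp⟩
    by_contra hi
    have hle := Ideal.toIdeal_homogeneousCore_le (ProjCI.grading n) p
    have hcore : J ≤ (Ideal.homogeneousCore (ProjCI.grading n) p).toIdeal := by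
      have h := Ideal.homogeneousCore_mono (ProjCI.grading n) hJp
      rwa [← toIdeal_le_toIdeal_iff, hJ.toIdeal_homogeneousCore_eq_self] at h
    obtain ⟨r, hr, hrf⟩ := h (pointOfPrime _ (Ideal.homogeneousCore (ProjCI.grading n) p).isHomogeneous
      hp.homogeneousCore ⟨i, fun h ↦ hi (hle h)⟩)
      (fun a ha ↦ hcore (I.mul_mem_right f ha))
    exact hr (hcore hrf)
  obtain ⟨N, hN⟩ := Ideal.exists_pow_le_of_le_radical_of_fg hrad
    (Submodule.fg_span (Set.finite_range _))
  exact mem_of_pow_mul_mem hsat hN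

/-- The lower bound, for an ideal with the Hilbert function and the saturation property of a
complete intersection. -/
theorem lt_sum_maxIdealOrder {g : Fin n → ProjCI.S n}
    (hI : (ProjCI.idealOf g).IsHomogeneous (ProjCI.grading n))
    (hsat : ∀ f, (∀ a ∈ Ideal.span (Set.range X), a * f ∈ ProjCI.idealOf g) → f ∈ ProjCI.idealOf g)
    {p : Polynomial ℤ} {d : ℕ}
    (hp : hilbertSeries (ProjCI.idealOf g) * (1 - PowerSeries.X) = (p : PowerSeries ℤ))
    (hd : 0 < p.coeff d) {m : ℕ}
    (hm : ∀ t, formsDim (Fin (n + 1)) ℂ t ≤ idealDim (ProjCI.idealOf g) t + m)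
    [Fintype (ProjCI.supp g)] [∀ q : ProjCI.supp g, IsArtinianRing (ProjCI.localRing g q)] :
    d < ∑ q : ProjCI.supp g, ProjCI.maxIdealOrder (ProjCI.localRing g q) := by
  by_contra! hle
  obtain ⟨l, hl, hl0, hlq⟩ := exists_linear_form_notMem (fun q : ProjCI.supp g ↦ q.1)
  refine not_homogeneousSubmodule_le_sup_span hI hp hd hl hl0 ?_
  -- One slot for each linear factor: the point `q` receives `o(m'_q)` of them.
  let ι := Σ q : ProjCI.supp g, Fin (ProjCI.maxIdealOrder (ProjCI.localRing g q))
  have hι : Fintype.card ι = ∑ q : ProjCI.supp g, ProjCI.maxIdealOrder (ProjCI.localRing g q) := by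
    simp [ι]
  rw [← hι] at hle
  have hprod (y : ι → ProjCI.S n) (hy : ∀ i, (y i).IsHomogeneous 1) :
      ∏ i, y i ∈ ProjCI.idealOf g ⊔ Ideal.span {l} := by
    have hex (i : ι) : ∃ c : ℂ, y i - C c * l ∈ i.1.1.asHomogeneousIdeal.toIdeal := by
      have := i.1.1.isPrime
      exact exists_sub_C_mul_mem (P := i.1.1.asHomogeneousIdeal.toIdeal)
        (fun t ↦ (hm t).trans (Nat.add_le_add_right (idealDim_mono i.1.2 t) m)) hl (hlq i.1) (hy i)
    choose c hc using hex
    have hz (i : ι) : (y i - C (c i) * l).IsHomogeneous 1 := (hy i).sub (hl.C_mul _)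
    have h1 : ∏ i, (y i - C (c i) * l) ∈ ProjCI.idealOf g := by
      refine mem_of_forall_exists_mul_mem hI hsat
        (IsHomogeneous.prod _ _ (fun _ ↦ 1) fun i _ ↦ hz i) fun q hq ↦ ?_
      let q' : ProjCI.supp g := ⟨q, hq⟩
      obtain ⟨r, hr, h⟩ := exists_mul_prod_mem g q' hl (hlq q') Finset.univ (by simp)
        (fun i ↦ y ⟨q', i⟩ - C (c ⟨q', i⟩) * l) (fun i ↦ hz _) fun i ↦ hc ⟨q', i⟩
      refine ⟨r, hr, Ideal.mem_of_dvd _ (mul_dvd_mul_left r ?_) h⟩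
      rw [Fintype.prod_sigma]
      exact Finset.dvd_prod_of_mem
        (fun q ↦ ∏ i, (y ⟨q, i⟩ - C (c ⟨q, i⟩) * l)) (Finset.mem_univ q')
    have h2 : _ ∈ _ ⊔ Ideal.span {l} := Ideal.mem_sup_left h1
    rw [← Ideal.Quotient.eq_zero_iff_mem, map_prod] at h2 ⊢
    rw [← h2]
    refine Finset.prod_congr rfl fun i _ ↦ (Ideal.Quotient.eq.2 ?_)
    rw [sub_sub_cancel]
    exact Ideal.mul_mem_left _ _ (Ideal.mem_sup_right (Ideal.mem_span_singleton_self l))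
  have hpow : homogeneousSubmodule (Fin (n + 1)) ℂ 1 ^ Fintype.card ι ≤
      (ProjCI.idealOf g ⊔ Ideal.span {l}).restrictScalars ℂ := by
    rw [Submodule.pow_eq_span_pow_set, Submodule.span_le]
    intro x hx
    obtain ⟨f, rfl⟩ := Set.mem_pow.1 hx
    rw [List.prod_ofFn, ← (Fintype.equivFin ι).prod_comp]
    exact hprod _ fun i ↦ (f _).2
  -- Forms of degree `d` are spanned by multiples of products of `Fintype.card ι ≤ d` linear forms.
  obtain ⟨r, rfl⟩ := Nat.exists_eq_add_of_le hle
  rw [← homogeneousSubmodule_one_pow, pow_add]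
  exact Submodule.mul_le.2 fun a ha b _ ↦
    Ideal.mul_mem_right (I := ProjCI.idealOf g ⊔ Ideal.span {l}) b (hpow ha)

theorem finite_supp_and_isArtinianRing_and_le_finsum {e : ℕ} (he : 0 < e) (g : Fin n → ProjCI.S n)
    (hg : ∀ i, (g i).IsHomogeneous e)
    (hreg : RingTheory.Sequence.IsRegular (ProjCI.S n) (List.ofFn g)) :
    (ProjCI.supp g).Finite ∧
      (∀ q : ProjCI.supp g, IsArtinianRing (ProjCI.localRing g q)) ∧
      n * (e - 1) + 1 ≤ ∑ᶠ q : ProjCI.supp g, ProjCI.maxIdealOrder (ProjCI.localRing g q) := by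
  have hg' : ∀ r ∈ List.ofFn g, r.IsHomogeneous e := List.forall_mem_ofFn_iff.2 hg
  have hI : (ProjCI.idealOf g).IsHomogeneous (ProjCI.grading n) := by
    rw [ProjCI.idealOf, ← ofList_ofFn]
    exact isHomogeneous_ofList hg'
  have hX : ∀ r ∈ List.ofFn (X : Fin (n + 1) → ProjCI.S n), r.IsHomogeneous 1 :=
    List.forall_mem_ofFn_iff.2 (isHomogeneous_X ℂ)
  have hXmem (i) : X i ∈ Ideal.ofList (List.ofFn (X : Fin (n + 1) → ProjCI.S n)) :=
    Ideal.subset_span (List.mem_ofFn.2 ⟨i, rfl⟩)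
  have hp := hilbertSeries_ofList_mul hX (isRegular_ofFn_X (n + 1)) hXmem (by simp) hg'
    hreg.toIsWeaklyRegular
  rw [ofList_ofFn, ← ProjCI.idealOf, List.length_ofFn] at hp
  obtain ⟨m, hm⟩ := exists_formsDim_le hp
  have hfin : (ProjCI.supp g).Finite := finite_zeroLocus hI hm
  have hart (q : ProjCI.supp g) : IsArtinianRing (ProjCI.localRing g q) :=
    isArtinianRing_quotient_stalkIdeal hm q.1
  refine ⟨hfin, hart, ?_⟩
  have := hfin.fintype
  rw [finsum_eq_sum_of_fintype]
  refine lt_sum_maxIdealOrder hI (fun f hf ↦ ?_) hp (by rw [coeff_geom_sum_pow e n he]; exact one_pos)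
    hm
  rw [ProjCI.idealOf, ← ofList_ofFn g] at hf ⊢
  refine mem_ofList_of_forall_mul_mem (Ideal.span (Set.range X)) (fun h ↦ ?_) (List.ofFn X) _
    (fun a ha ↦ Ideal.subset_span (List.mem_ofFn.1 ha)) (isRegular_ofFn_X (n + 1))
    hreg.toIsWeaklyRegular (by simp only [List.length_ofFn]; omega) f hf
  refine (isRegular_ofFn_X (n + 1)).top_ne_smul ?_
  rw [ofList_ofFn, h, smul_eq_mul, Ideal.mul_top]

end LowerBound

/-! ### Sharpness for powers of variables -/

section Sharpness

variable {n : ℕ}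

/-- Pigeonhole: among `n(e-1) + 1` factors taken from `n` elements, some element occurs at least `e`
times. -/
theorem span_range_pow_le {R : Type*} [CommRing R] (x : Fin n → R) (e : ℕ) :
    Ideal.span (Set.range x) ^ (n * (e - 1) + 1) ≤ Ideal.span (Set.range fun i ↦ x i ^ e) := by
  classical
  rw [Ideal.span, Submodule.span_pow, Submodule.span_le]
  intro y hy
  obtain ⟨f, rfl⟩ := Set.mem_pow.1 hy
  choose j hj using fun i ↦ (f i).2
  obtain ⟨i, -, hi⟩ := Finset.exists_lt_card_fiber_of_mul_lt_card_of_maps_to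
    (s := Finset.univ) (t := Finset.univ) (f := j) (n := e - 1) (fun _ _ ↦ Finset.mem_univ _)
    (by simp)
  rw [List.prod_ofFn]
  refine Ideal.mem_of_dvd _ ?_ (Ideal.subset_span (Set.mem_range_self i))
  refine (pow_dvd_pow _ (by omega :
    e ≤ (Finset.univ.filter fun k ↦ j k = i).card)).trans ?_
  rw [← Finset.prod_const]
  have h : ∏ k with j k = i, (f k : R) = ∏ k with j k = i, x i :=
    Finset.prod_congr rfl fun k hk ↦ by rw [← hj, (Finset.mem_filter.1 hk).2]
  rw [← h]
  exact Finset.prod_dvd_prod_of_subset _ _ _ (Finset.filter_subset _ _)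

theorem maximalIdeal_pow_eq_bot {g : Fin n → ProjCI.S n} (q : ProjCI.supp g) {N : ℕ}
    (h : q.1.asHomogeneousIdeal.toIdeal ^ N ≤ ProjCI.idealOf g) :
    IsLocalRing.maximalIdeal (ProjCI.localRing g q) ^ N = ⊥ := by
  have := q.1.isPrime
  have h1 : IsLocalRing.maximalIdeal (ProjCI.localRing g q) ≤
      (IsLocalRing.maximalIdeal (ProjCI.localRingPn q.1)).map
        (Ideal.Quotient.mk (ProjCI.stalkIdeal (ProjCI.idealOf g) q.1)) := by
    intro b hb
    obtain ⟨x, rfl⟩ := Ideal.Quotient.mk_surjective b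
    refine Ideal.mem_map_of_mem _ fun hx ↦ hb ?_
    exact hx.map _
  have h2 : IsLocalRing.maximalIdeal (ProjCI.localRingPn q.1) ≤
      (q.1.asHomogeneousIdeal.toIdeal.map (algebraMap (ProjCI.S n) (ambientLocalRing q.1))).comap
        (algebraMap (ProjCI.localRingPn q.1) (ambientLocalRing q.1)) := by
    intro x hx
    rw [Ideal.mem_comap, Localization.AtPrime.map_eq_maximalIdeal]
    exact fun hu ↦ hx ((HomogeneousLocalization.isUnit_iff_isUnit_val _ _ _).1 hu)
  have h3 : IsLocalRing.maximalIdeal (ProjCI.localRingPn q.1) ^ N ≤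
      ProjCI.stalkIdeal (ProjCI.idealOf g) q.1 := by
    refine (Ideal.pow_right_mono h2 N).trans ((Ideal.le_comap_pow _ N).trans ?_)
    rw [← Ideal.map_pow]
    exact Ideal.comap_mono (Ideal.map_mono h)
  rw [eq_bot_iff]
  refine (Ideal.pow_right_mono h1 N).trans ?_
  rw [← Ideal.map_pow, Ideal.map_le_iff_le_comap, ← RingHom.ker_eq_comap_bot, Ideal.mk_ker]
  exact h3

/-- The prime contains `x₁, …, xₙ`, hence not `x₀`. Modulo these variables every linear form is a
multiple of `x₀`, which leaves room for only one point. -/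
theorem toIdeal_eq_span_of_mem_supp {e : ℕ}
    (q : ProjCI.supp fun i : Fin n ↦ (X i.succ ^ e : ProjCI.S n)) :
    q.1.asHomogeneousIdeal.toIdeal = Ideal.span (Set.range fun i : Fin n ↦ X i.succ) := by
  have := q.1.isPrime
  have hmem (i : Fin n) : X i.succ ∈ q.1.asHomogeneousIdeal.toIdeal :=
    Ideal.IsPrime.mem_of_pow_mem this e (q.2 (Ideal.subset_span ⟨i, rfl⟩))
  have hle : Ideal.span (Set.range fun i : Fin n ↦ X i.succ) ≤ q.1.asHomogeneousIdeal.toIdeal := by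
    rw [Ideal.span_le]
    rintro _ ⟨i, rfl⟩
    exact hmem i
  have h0 : X 0 ∉ q.1.asHomogeneousIdeal.toIdeal := fun h ↦ by
    obtain ⟨i, hi⟩ := exists_X_notMem q.1
    exact hi (Fin.cases h hmem i)
  refine le_antisymm (le_of_forall_exists_sub_mem
    q.1.asHomogeneousIdeal.isHomogeneous h0 fun y hy ↦ ?_) hle
  rw [inf_eq_right.2 hle]
  have hy' : y ∈ Submodule.span ℂ (Set.range X) := by
    rw [← homogeneousSubmodule_one_eq_span_X]
    exact hy
  clear hy
  induction hy' using Submodule.span_induction with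
  | mem x hx =>
    obtain ⟨i, rfl⟩ := hx
    refine Fin.cases ⟨1, by simp⟩ (fun i ↦ ⟨0, ?_⟩) i
    simpa using Ideal.subset_span (Set.mem_range_self i)
  | zero => exact ⟨0, by simp⟩
  | add a b _ _ ha hb =>
    obtain ⟨c, hc⟩ := ha
    obtain ⟨c', hc'⟩ := hb
    refine ⟨c + c', ?_⟩
    convert Ideal.add_mem _ hc hc' using 1
    rw [C_add]
    ring
  | smul r a _ ha =>
    obtain ⟨c, hc⟩ := ha
    refine ⟨r * c, ?_⟩
    convert Ideal.mul_mem_left _ (C r) hc using 1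
    rw [C_mul, smul_eq_C_mul]
    ring

theorem finsum_maxIdealOrder_X_pow_le (n e : ℕ) :
    ∑ᶠ q : ProjCI.supp fun i : Fin n ↦ (X i.succ ^ e : ProjCI.S n),
      ProjCI.maxIdealOrder (ProjCI.localRing _ q) ≤ n * (e - 1) + 1 := by
  have hsub : Subsingleton (ProjCI.supp fun i : Fin n ↦ (X i.succ ^ e : ProjCI.S n)) :=
    ⟨fun q p ↦ Subtype.ext (ProjectiveSpectrum.ext (HomogeneousIdeal.toIdeal_injective
      ((toIdeal_eq_span_of_mem_supp q).trans (toIdeal_eq_span_of_mem_supp p).symm)))⟩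
  rcases isEmpty_or_nonempty (ProjCI.supp fun i : Fin n ↦ (X i.succ ^ e : ProjCI.S n)) with h | ⟨⟨q⟩⟩
  · rw [finsum_of_isEmpty]
    exact Nat.zero_le _
  · rw [finsum_eq_single _ q fun p hp ↦ (hp (Subsingleton.elim p q)).elim]
    refine Nat.sInf_le ⟨Nat.succ_pos _, maximalIdeal_pow_eq_bot q ?_⟩
    rw [toIdeal_eq_span_of_mem_supp]
    exact span_range_pow_le _ e

end Sharpness

theorem corollary2p8 (n e : ℕ) (he : 0 < e) :
    (∀ g : Fin n → ProjCI.S n,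
      (∀ i, (g i).IsHomogeneous e) →
      RingTheory.Sequence.IsRegular (ProjCI.S n) (List.ofFn g) →
        (ProjCI.supp g).Finite ∧
        (∀ q : ProjCI.supp g, IsArtinianRing (ProjCI.localRing g q)) ∧
        n * (e - 1) + 1 ≤ ∑ᶠ q : ProjCI.supp g, ProjCI.maxIdealOrder (ProjCI.localRing g q)) ∧
    (∃ g : Fin n → ProjCI.S n,
      (∀ i, (g i).IsHomogeneous e) ∧
      RingTheory.Sequence.IsRegular (ProjCI.S n) (List.ofFn g) ∧
      ∑ᶠ q : ProjCI.supp g, ProjCI.maxIdealOrder (ProjCI.localRing g q) = n * (e - 1) + 1) := by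
  refine ⟨finite_supp_and_isArtinianRing_and_le_finsum he, fun i ↦ X i.succ ^ e,
    fun i ↦ isHomogeneous_X_pow _ _, isRegular_ofFn_X_pow _ (Fin.succ_injective n) e he, ?_⟩
  exact le_antisymm (finsum_maxIdealOrder_X_pow_le n e)
    (finite_supp_and_isArtinianRing_and_le_finsum he _ (fun i ↦ isHomogeneous_X_pow _ _)
      (isRegular_ofFn_X_pow _ (Fin.succ_injective n) e he)).2.2
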